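/- Let $N\ge 2$, $d\ge 1$, and let $G=(\{1,\dots,N\},\mathcal E)$ be a connected undirected simple graph with Laplacian matrix $W\in\mathbb R^{N\times N}$, i.e. $W_{ii}$ is the degree of $i$, $W_{ij}=-1$ if $\{i,j\}\in\mathcal E$, and $W_{ij}=0$ otherwise. Let $\lambda_{\max}$ be the largest and $\lambda^+_{\min}$ the smallest non-zero eigenvalue of $W$. Let $\mu>0$, and let $f_1,\dots,f_N:\mathbb R^d\to\mathbb R$ be differentiable, $\mu$-strongly convex, with $L$-Lipschitz gradients. For $x=(x_1,\dots,x_N)$ and $c=(c_1,\dots,c_N)$ in $\mathbb R^{Nd}$ and $\gamma\in\mathbb R$ define $A(c,x)\in\mathbb R^{Nd}$ and $C(x)\in\mathbb R^{Nd}$ blockwise by $$A(c,x)_i=x_i+\gamma\sum_{j=1}^N W_{ij}c_j,\qquad C(x)_i=\operatorname{argmin}_{c_i\in\mathbb R^d}\; f_i(c_i)+\langle c_i,x_i\rangle ,$$ and consider the iteration $x^0=0$, $c^0_i=\operatorname{argmin} f_i$, $x^{k+1}=A(c^k,x^k)$, $c^{k+1}=C(x^{k+1})$. Put $\mathcal X=\operatorname{Im}(W\otimes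 I_d)\subseteq\mathbb R^{Nd}$. Let $W\otimes I_d=Q^{\top}\Lambda Q$ be an orthogonal eigenvalue decomposition, let $B$ be the matrix formed by the non-zero rows of $\sqrt{\Lambda}\,Q$, let $M=(BB^{\top})^{-1}B$ and $\|x\|_M=\|Mx\|_2$. Then: 1. The minimizers defining $C$ exist and are unique. 2. For every $\gamma\in\mathbb R$, $A(c,x)\in\mathcal X$ for all $c\in\mathbb R^{Nd}$ and $x\in\mathcal X$; in particular all iterates $x^k$ lie in $\mathcal X$. 3. $\|\cdot\|_M$ is a norm on $\mathcal X$. 4. Let $$\gamma=\frac{2L\mu}{\mu\lambda^+_{\min}+L\lambda_{\max}},\qquad \kappa(W)=\frac{\lambda_{\max}L}{\mu\lambda^+_{\min}},\qquad \sigma=1-\frac{2}{\kappa(W)+1}.$$ Then $0\le\sigma<1$, the map $x\mapsto A(C(x),x)$ has a unique fixed point $x^\star$ in $\mathcal X$, and $$\|A(C(x),x)-x^\star\|_M\le\sigma\,\|x-x^\star\|_M\qquad\text{for all }x\in\mathcal X.$$ 5. For every $\gamma\in\mathbb R$ there is a constant $L_A\ge 0$ with $\|A(c_1,x)-A(c_2,x)\|_M\le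 L_A\|c_1-c_2\|_\infty$ for all $c_1,c_2\in\mathbb R^{Nd}$ and $x\in\mathcal X$, and there is a constant $L_C\ge 0$ with $\|C(x_1)-C(x_2)\|_\infty\le L_C\|x_1-x_2\|_M$ for all $x_1,x_2\in\mathcal X$. -/

import Mathlib

open scoped NNReal Kronecker

namespace DualDecomp

noncomputable section

/-- The largest eigenvalue of a real square matrix. -/
def lamMax {n : Type*} [Fintype n] [DecidableEq n] (W : Matrix n n ℝ) : ℝ :=
  sSup {t : ℝ | Module.End.HasEigenvalue (Matrix.toLin' W) t}

/-- The smallest non-zero eigenvalue of a real square matrix. -/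
def lamMinPos {n : Type*} [Fintype n] [DecidableEq n] (W : Matrix n n ℝ) : ℝ :=
  sInf {t : ℝ | Module.End.HasEigenvalue (Matrix.toLin' W) t ∧ t ≠ 0}

/-- The local variables live in `ℝ^d` with the Euclidean norm. -/
abbrev Loc (d : ℕ) : Type := EuclideanSpace ℝ (Fin d)

/-- The stacked variables live in `ℝ^{Nd}`; the coordinate `(i, a)` is the `a`-th entry of the
`i`-th block. -/
abbrev Stacked (N d : ℕ) : Type := EuclideanSpace ℝ (Fin N × Fin d)

/-- The `i`-th block `x_i` of a stacked vector. -/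
def block {N d : ℕ} (x : Stacked N d) (i : Fin N) : Loc d :=
  WithLp.toLp 2 fun a => x (i, a)

/-- The stacked vector `(x_1, …, x_N)`. -/
def stack {N d : ℕ} (x : Fin N → Loc d) : Stacked N d :=
  WithLp.toLp 2 fun p => x p.1 p.2

/-- The `ℓ^∞` norm on `ℝ^{Nd}` (Mathlib's norm on plain functions is the sup norm). -/
def linfNorm {N d : ℕ} (c : Stacked N d) : ℝ := ‖WithLp.ofLp c‖

/-- A minimizer of `h` over the whole space (an arbitrary point if there is none). -/
def argmin {E : Type*} [Nonempty E] (h : E → ℝ) : E :=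
  Classical.epsilon fun c => ∀ c', h c ≤ h c'

/-- The objective `c_i ↦ f_i(c_i) + ⟨c_i, x_i⟩` of the local primal problem. -/
def localObj {d : ℕ} (fi : Loc d → ℝ) (xi : Loc d) (c : Loc d) : ℝ :=
  fi c + inner ℝ c xi

/-- The communication map `C(x) = (C_1(x_1), …, C_N(x_N))` with
`C_i(x_i) = argmin_{c_i} f_i(c_i) + ⟨c_i, x_i⟩`. -/
def commMap {N d : ℕ} (f : Fin N → Loc d → ℝ) (x : Stacked N d) : Stacked N d :=
  stack fun i => argmin (localObj (f i) (block x i))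

section Graph

variable {N : ℕ} (G : SimpleGraph (Fin N)) [DecidableRel G.Adj]

/-- The algorithm update `A(c, x)`, whose `i`-th block is `x_i + γ ∑_j W_{ij} c_j`,
where `W` is the Laplacian matrix of the graph. -/
def algMap {d : ℕ} (γ : ℝ) (c x : Stacked N d) : Stacked N d :=
  stack fun i => block x i + γ • ∑ j, G.lapMatrix ℝ i j • block c j

/-- The iterates `(x^k, c^k)` of the algorithm: `x^0 = 0`, `c_i^0 = argmin f_i`,
`x^{k+1} = A(c^k, x^k)`, `c^{k+1} = C(x^{k+1})`. -/
def iterates {d : ℕ} (f : Fin N → Loc d → ℝ) (γ : ℝ) : ℕ → Stacked N d × Stacked N d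
  | 0 => (0, stack fun i => argmin (f i))
  | k + 1 =>
    let x' := algMap G γ (iterates f γ k).2 (iterates f γ k).1
    (x', commMap f x')

/-- The matrix `W ⊗ I_d`. -/
def bigW (d : ℕ) : Matrix (Fin N × Fin d) (Fin N × Fin d) ℝ :=
  G.lapMatrix ℝ ⊗ₖ (1 : Matrix (Fin d) (Fin d) ℝ)

/-- The set `X = Im(W ⊗ I_d)`. -/
def imW (d : ℕ) : Submodule ℝ (Stacked N d) :=
  LinearMap.range (Matrix.toEuclideanLin (bigW G d))

theorem bigW_isHermitian (d : ℕ) : (bigW G d).IsHermitian := by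
  have h : (G.lapMatrix ℝ).transpose = G.lapMatrix ℝ := G.isSymm_lapMatrix ℝ
  unfold bigW Matrix.IsHermitian
  rw [Matrix.conjTranspose_eq_transpose_of_trivial, ← Matrix.kroneckerMap_transpose, h,
    Matrix.transpose_one]

/-- The matrix square root `√Λ Q` of `W ⊗ I_d`, where `W ⊗ I_d = Qᵀ Λ Q` is an orthogonal
eigenvalue decomposition (the rows of `Q` are orthonormal eigenvectors). -/
def sqrtW (d : ℕ) : Matrix (Fin N × Fin d) (Fin N × Fin d) ℝ :=
  Matrix.diagonal (fun p => Real.sqrt ((bigW_isHermitian G d).eigenvalues p)) *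
    ((bigW_isHermitian G d).eigenvectorUnitary : Matrix (Fin N × Fin d) (Fin N × Fin d) ℝ).transpose

/-- The indices of the non-zero rows of `√Λ Q`. -/
abbrev RowIdx (d : ℕ) : Type :=
  {p : Fin N × Fin d // (bigW_isHermitian G d).eigenvalues p ≠ 0}

/-- The matrix formed by the non-zero rows of `√Λ Q`. -/
def redSqrtW (d : ℕ) : Matrix (RowIdx G d) (Fin N × Fin d) ℝ :=
  (sqrtW G d).submatrix Subtype.val id

open Classical in
/-- The matrix `M = (B Bᵀ)⁻¹ B`, where `B` consists of the non-zero rows of `√Λ Q`. -/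
def matM (d : ℕ) : Matrix (RowIdx G d) (Fin N × Fin d) ℝ :=
  (redSqrtW G d * (redSqrtW G d).transpose)⁻¹ * redSqrtW G d

open Classical in
/-- The weighted norm `‖x‖_M = ‖M x‖₂`. -/
def normM {d : ℕ} (x : Stacked N d) : ℝ :=
  ‖(WithLp.toLp 2 ((matM G d).mulVec (WithLp.ofLp x)) : EuclideanSpace ℝ (RowIdx G d))‖

/-- The step size `γ = 2Lμ / (μ λ⁺_min(W) + L λ_max(W))`. -/
def stepSize (μ L : ℝ) : ℝ :=
  2 * L * μ / (μ * lamMinPos (G.lapMatrix ℝ) + L * lamMax (G.lapMatrix ℝ))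

/-- The condition number `κ(W) = λ_max(W) L / (μ λ⁺_min(W))`. -/
def kappa (μ L : ℝ) : ℝ :=
  lamMax (G.lapMatrix ℝ) * L / (μ * lamMinPos (G.lapMatrix ℝ))

/-- The contraction factor `σ = 1 - 2 / (κ(W) + 1)`. -/
def rate (μ L : ℝ) : ℝ := 1 - 2 / (kappa G μ L + 1)

end Graph

/-- `ν` restricts to a norm on the subspace `S`. -/
def IsNormOn {E : Type*} [AddCommGroup E] [Module ℝ E] (S : Submodule ℝ E) (ν : E → ℝ) : Prop :=
  (∀ x ∈ S, 0 ≤ ν x) ∧ (∀ x ∈ S, ν x = 0 ↔ x = 0) ∧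
  (∀ (a : ℝ), ∀ x ∈ S, ν (a • x) = |a| * ν x) ∧
  (∀ x ∈ S, ∀ y ∈ S, ν (x + y) ≤ ν x + ν y)

end

end DualDecomp

/-! Since `M Bᵀ = I` and `X` is the range of `Bᵀ`, the substitution `x = Bᵀ y` identifies the
Euclidean `y`-space isometrically with `X` under `‖·‖_M`. As `Bᵀ B = W ⊗ I`, the iteration becomes
`y ↦ y + γ B C(Bᵀ y)`.

The map `C` inverts the gradients: `∇f_i(C_i(x_i)) = -x_i`. Hence `v = x₁ - x₂` and `u = C(x₂) -
C(x₁)` satisfy the interpolation inequality `0 ≤ ⟪v - μ u, L u - v⟫`, which says that `u` lies in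
the ball with centre `s v` and radius `r ‖v‖`, where `s ± r` are `1/μ` and `1/L`. A scaled
reflection then gives a symmetric `R` with norm at most `r` and `u = (s + R) v`; it replaces an
averaged inverse Hessian, so no second derivatives are needed.

Two steps of the iteration thus differ by `I - γ B (s + R) Bᵀ` applied to `y₁ - y₂`. The quadratic
form of `B (s + R) Bᵀ` lies between `λ⁺_min / L` and `λ_max / μ`, and the chosen `γ` balances the
two ends, giving norm at most `σ`. Banach's theorem supplies the fixed point. -/

/-! ### Strong convexity, smoothness and minimizers -/

section Analysis

variable {E F : Type*} [NormedAddCommGroup E] [InnerProductSpace ℝ E]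
  [NormedAddCommGroup F] [InnerProductSpace ℝ F]

open scoped RealInnerProductSpace

/-- The derivative of a differentiable function along a line. -/
theorem hasDerivAt_comp_line [CompleteSpace E] {f : E → ℝ} (hf : Differentiable ℝ f)
    (x v : E) (t : ℝ) :
    HasDerivAt (fun s : ℝ => f (x + s • v)) ⟪gradient f (x + t • v), v⟫ t := by
  have h1 : HasDerivAt (fun s : ℝ => x + s • v) v t := by
    simpa using ((hasDerivAt_id t).smul_const v).const_add x
  have h2 := (hf (x + t • v)).hasFDerivAt.comp_hasDerivAt t h1
  rwa [← inner_gradient_left] at h2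

/-- The descent lemma: the quadratic upper bound for a function with Lipschitz gradient. -/
theorem le_add_inner_gradient_add_sq [CompleteSpace E] {f : E → ℝ} {L : ℝ≥0}
    (hf : Differentiable ℝ f) (hL : LipschitzWith L (gradient f)) (x y : E) :
    f y ≤ f x + ⟪gradient f x, y - x⟫ + L / 2 * ‖y - x‖ ^ 2 := by
  set v := y - x with hv
  -- The claim is `g 1 ≤ g 0`; the Lipschitz bound on the gradient makes `g` nonincreasing on `[0,
  -- 1]`.
  let g : ℝ → ℝ := fun t => f (x + t • v) - t * ⟪gradient f x, v⟫ - L / 2 * t ^ 2 * ‖v‖ ^ 2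
  have hg : ∀ t, HasDerivAt g
      (⟪gradient f (x + t • v), v⟫ - ⟪gradient f x, v⟫ - L * t * ‖v‖ ^ 2) t := by
    intro t
    have h1 := (hasDerivAt_id t).mul_const ⟪gradient f x, v⟫
    have h2 := (((hasDerivAt_id t).pow 2).const_mul (L / 2 : ℝ)).mul_const (‖v‖ ^ 2)
    refine (((hasDerivAt_comp_line hf x v t).sub h1).sub h2).congr_deriv ?_
    simp only [id, Nat.cast_ofNat]
    ring
  have hanti : AntitoneOn g (Set.Icc 0 1) := by
    refine antitoneOn_of_deriv_nonpos (convex_Icc 0 1)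
      (fun t _ => (hg t).continuousAt.continuousWithinAt)
      (fun t _ => (hg t).differentiableAt.differentiableWithinAt) fun t ht => ?_
    rw [interior_Icc] at ht
    rw [(hg t).deriv, ← inner_sub_left]
    have h1 := real_inner_le_norm (gradient f (x + t • v) - gradient f x) v
    have h2 : ‖gradient f (x + t • v) - gradient f x‖ ≤ L * (t * ‖v‖) := by
      have := hL.norm_sub_le (x + t • v) x
      rwa [add_sub_cancel_left, norm_smul, Real.norm_of_nonneg ht.1.le] at this
    have h3 := mul_le_mul_of_nonneg_right h2 (norm_nonneg v)
    linarith [show (L : ℝ) * (t * ‖v‖) * ‖v‖ = L * t * ‖v‖ ^ 2 by ring]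
  have h := hanti (Set.left_mem_Icc.2 zero_le_one) (Set.right_mem_Icc.2 zero_le_one) zero_le_one
  simp only [g, one_smul, zero_smul, add_zero, hv, add_sub_cancel] at h
  linarith

/-- The first-order characterization of strong convexity. -/
theorem StrongConvexOn.add_inner_gradient_add_sq_le [CompleteSpace E] {f : E → ℝ} {m : ℝ}
    (hc : StrongConvexOn Set.univ m f) (hf : Differentiable ℝ f) (x y : E) :
    f x + ⟪gradient f x, y - x⟫ + m / 2 * ‖y - x‖ ^ 2 ≤ f y := by
  set v := y - x with hv
  have hconv : ConvexOn ℝ Set.univ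
      (fun t : ℝ => f (x + t • v) - m / 2 * ‖x + t • v‖ ^ 2) := by
    have := (strongConvexOn_iff_convex.1 hc).comp_affineMap (AffineMap.lineMap x y : ℝ →ᵃ[ℝ] E)
    simpa [Function.comp_def, AffineMap.lineMap_apply, ← hv, add_comm] using this
  have hd : HasDerivAt (fun t : ℝ => f (x + t • v) - m / 2 * ‖x + t • v‖ ^ 2)
      (⟪gradient f x, v⟫ - m * ⟪x, v⟫) 0 := by
    have h1 : HasDerivAt (fun s : ℝ => x + s • v) v 0 := by
      simpa using ((hasDerivAt_id (0 : ℝ)).smul_const v).const_add x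
    refine ((hasDerivAt_comp_line hf x v 0).sub (h1.norm_sq.const_mul (m / 2))).congr_deriv ?_
    simp
    ring
  have h := hconv.le_slope_of_hasDerivAt (Set.mem_univ 0) (Set.mem_univ 1) zero_lt_one hd
  rw [slope_def_field] at h
  have h2 : ‖x + v‖ ^ 2 = ‖x‖ ^ 2 + 2 * ⟪x, v⟫ + ‖v‖ ^ 2 := norm_add_sq_real x v
  have h3 : x + v = y := by rw [hv]; abel
  simp only [one_smul, zero_smul, add_zero, sub_zero, div_one, h3] at h
  rw [h3] at h2
  rw [h2] at h
  linarith

/-- The strong convexity modulus is at most the Lipschitz constant of the gradient. -/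
theorem StrongConvexOn.le_of_lipschitzWith_gradient [CompleteSpace E] [Nontrivial E]
    {f : E → ℝ} {m : ℝ} {L : ℝ≥0} (hc : StrongConvexOn Set.univ m f)
    (hf : Differentiable ℝ f) (hL : LipschitzWith L (gradient f)) : m ≤ L := by
  obtain ⟨x, hx⟩ := exists_ne (0 : E)
  have h1 := le_add_inner_gradient_add_sq hf hL 0 x
  have h2 := hc.add_inner_gradient_add_sq_le hf 0 x
  rw [sub_zero] at h1 h2
  have h3 : 0 < ‖x‖ ^ 2 := by positivity
  by_contra! h
  nlinarith

/-- The interpolation inequality for strongly convex functions with Lipschitz gradient. -/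
theorem StrongConvexOn.inner_gradient_sub_nonneg [CompleteSpace E] {f : E → ℝ} {m : ℝ} {L : ℝ≥0}
    (hc : StrongConvexOn Set.univ m f) (hf : Differentiable ℝ f)
    (hL : LipschitzWith L (gradient f)) (hmL : m ≤ L) (x y : E) :
    0 ≤ ⟪(gradient f x - gradient f y) - m • (x - y),
      (L : ℝ) • (x - y) - (gradient f x - gradient f y)⟫ := by
  set w := (gradient f x - gradient f y) - m • (x - y) with hw
  -- The value `f (a - t • u)` is bounded above by smoothness at `a` and below by strong convexity
  -- at `b`; `t` stays free.
  have key : ∀ (a b : E) (t : ℝ),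
      f b + ⟪gradient f b, a - b⟫ + m / 2 * ‖a - b‖ ^ 2
        + (t - (L - m) / 2 * t ^ 2) * ‖(gradient f a - gradient f b) - m • (a - b)‖ ^ 2
      ≤ f a := by
    intro a b t
    set u := (gradient f a - gradient f b) - m • (a - b) with hu
    have h1 := le_add_inner_gradient_add_sq hf hL a (a - t • u)
    have h2 := hc.add_inner_gradient_add_sq_le hf b (a - t • u)
    rw [show a - t • u - a = -(t • u) by abel, inner_neg_right, inner_smul_right, norm_neg,
      norm_smul, mul_pow, Real.norm_eq_abs, sq_abs] at h1
    rw [show a - t • u - b = (a - b) - t • u by abel, inner_sub_right, inner_smul_right,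
      norm_sub_sq_real, inner_smul_right, norm_smul, mul_pow, Real.norm_eq_abs, sq_abs] at h2
    have h3 : ‖u‖ ^ 2 = ⟪gradient f a, u⟫ - ⟪gradient f b, u⟫ - m * ⟪a - b, u⟫ := by
      rw [← real_inner_self_eq_norm_sq]
      nth_rewrite 1 [hu]
      rw [inner_sub_left, inner_sub_left, inner_smul_left]
      simp
    have h4 : t * ‖u‖ ^ 2 =
        t * ⟪gradient f a, u⟫ - t * ⟪gradient f b, u⟫ - t * (m * ⟪a - b, u⟫) := by
      rw [h3]; ring
    linarith
  -- Adding `key` to its copy with `x` and `y` exchanged cancels the function values.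
  have hsum : ∀ t : ℝ, (2 * t - (L - m) * t ^ 2) * ‖w‖ ^ 2 ≤ ⟪w, x - y⟫ := by
    intro t
    have h1 := key x y t
    have h2 := key y x t
    rw [show (gradient f y - gradient f x) - m • (y - x) = -w by rw [hw, smul_sub, smul_sub]; abel,
      norm_neg, ← neg_sub x y, norm_neg, inner_neg_right] at h2
    rw [← hw] at h1
    have h3 : ⟪w, x - y⟫
        = ⟪gradient f x, x - y⟫ - ⟪gradient f y, x - y⟫ - m * ‖x - y‖ ^ 2 := by
      rw [hw, inner_sub_left, inner_sub_left, real_inner_smul_left, real_inner_self_eq_norm_sq]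
    rw [h3]
    linarith
  have hval : ⟪w, (L : ℝ) • (x - y) - (gradient f x - gradient f y)⟫
      = (L - m) * ⟪w, x - y⟫ - ‖w‖ ^ 2 := by
    rw [show (L : ℝ) • (x - y) - (gradient f x - gradient f y) = ((L : ℝ) - m) • (x - y) - w by
      rw [hw, sub_smul]; abel, inner_sub_right, inner_smul_right, real_inner_self_eq_norm_sq]
  rw [hval]
  rcases hmL.eq_or_lt with h | h
  -- If `m = L`, the quadratic term in `t` vanishes, and a bound linear in `t` for all `t` forces `w
  -- = 0`.
  · rw [h] at hsum ⊢
    have hw0 : ‖w‖ ^ 2 ≤ 0 := by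
      by_contra! hpos
      have h1 := hsum 1
      have h2 := hsum (⟪w, x - y⟫ / ‖w‖ ^ 2)
      have h3 : ⟪w, x - y⟫ / ‖w‖ ^ 2 * ‖w‖ ^ 2 = ⟪w, x - y⟫ := div_mul_cancel₀ _ hpos.ne'
      simp only [sub_self, zero_mul, sub_zero] at h1 h2
      rw [mul_assoc, h3] at h2
      linarith
    linarith
  · have hpos : 0 < (L : ℝ) - m := sub_pos.2 h
    -- This `t` maximizes `2 t - (L - m) t ^ 2`.
    have h1 := mul_le_mul_of_nonneg_left (hsum (1 / (L - m))) hpos.le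
    have h2 : ((L : ℝ) - m) * ((2 * (1 / (L - m)) - (L - m) * (1 / (L - m)) ^ 2) * ‖w‖ ^ 2)
        = ‖w‖ ^ 2 := by
      field_simp
      ring
    linarith

/-- A linear perturbation of a differentiable strongly convex function has a minimizer. -/
theorem StrongConvexOn.exists_forall_add_inner_le [FiniteDimensional ℝ E] {f : E → ℝ} {m : ℝ}
    (hm : 0 < m) (hc : StrongConvexOn Set.univ m f) (hf : Differentiable ℝ f) (x : E) :
    ∃ c, ∀ c', f c + ⟪c, x⟫ ≤ f c' + ⟪c', x⟫ := by
  have := FiniteDimensional.proper ℝ E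
  have : CompleteSpace E := FiniteDimensional.complete ℝ E
  have hcont : Continuous fun c => f c + ⟪c, x⟫ :=
    hf.continuous.add (continuous_id.inner continuous_const)
  refine hcont.exists_forall_le ?_
  set K := ‖gradient f 0 + x‖
  -- The quadratic lower bound at `0` gives coercivity.
  have hlow : ∀ c, f 0 + ‖c‖ * (m / 2 * ‖c‖ - K) ≤ f c + ⟪c, x⟫ := by
    intro c
    have h1 := hc.add_inner_gradient_add_sq_le hf 0 c
    rw [sub_zero] at h1
    have h2 : |⟪gradient f 0 + x, c⟫| ≤ K * ‖c‖ := abs_real_inner_le_norm _ _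
    rw [inner_add_left, real_inner_comm c x] at h2
    have h3 := (abs_le.1 h2).1
    linarith [show ‖c‖ * (m / 2 * ‖c‖ - K) = m / 2 * ‖c‖ ^ 2 - K * ‖c‖ by ring]
  refine Filter.tendsto_atTop_mono hlow (Filter.tendsto_atTop_add_const_left _ _ ?_)
  have hn := tendsto_norm_cocompact_atTop (E := E)
  refine hn.atTop_mul_atTop₀ ?_
  exact Filter.tendsto_atTop_add_const_right _ _ (hn.const_mul_atTop (by positivity))

/-- The gradient of `f` at a minimizer of `f + ⟪·, x⟫` is `-x`. -/
theorem gradient_eq_neg_of_forall_add_inner_le [CompleteSpace E] {f : E → ℝ}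
    (hf : Differentiable ℝ f) {x c : E} (h : ∀ c', f c + ⟪c, x⟫ ≤ f c' + ⟪c', x⟫) :
    gradient f c = -x := by
  refine eq_neg_of_add_eq_zero_left (ext_inner_right ℝ fun v => ?_)
  have h1 : HasDerivAt (fun s : ℝ => f (c + s • v) + ⟪c + s • v, x⟫)
      (⟪gradient f c, v⟫ + ⟪v, x⟫) 0 := by
    have h2 : HasDerivAt (fun s : ℝ => ⟪c, x⟫ + s * ⟪v, x⟫) ⟪v, x⟫ 0 := by
      simpa using ((hasDerivAt_id (0 : ℝ)).mul_const ⟪v, x⟫).const_add ⟪c, x⟫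
    have h3 := (hasDerivAt_comp_line hf c v 0).add h2
    simp only [zero_smul, add_zero] at h3
    refine h3.congr_of_eventuallyEq (Filter.Eventually.of_forall fun s => ?_)
    simp [inner_add_left, real_inner_smul_left]
  have hmin : IsLocalMin (fun s : ℝ => f (c + s • v) + ⟪c + s • v, x⟫) 0 :=
    Filter.Eventually.of_forall fun s => by simpa using h (c + s • v)
  rw [inner_add_left, inner_zero_left, real_inner_comm v x]
  exact hmin.hasDerivAt_eq_zero h1

/-- A linear perturbation of a differentiable strongly convex function has exactly one
minimizer. -/
theorem StrongConvexOn.existsUnique_forall_add_inner_le [FiniteDimensional ℝ E] {f : E → ℝ}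
    {m : ℝ} (hm : 0 < m) (hc : StrongConvexOn Set.univ m f) (hf : Differentiable ℝ f) (x : E) :
    ∃! c, ∀ c', f c + ⟪c, x⟫ ≤ f c' + ⟪c', x⟫ := by
  have : CompleteSpace E := FiniteDimensional.complete ℝ E
  obtain ⟨c, h⟩ := hc.exists_forall_add_inner_le hm hf x
  refine ⟨c, h, fun y hy => ?_⟩
  have h1 := hc.add_inner_gradient_add_sq_le hf c y
  rw [gradient_eq_neg_of_forall_add_inner_le hf h, inner_neg_left, inner_sub_right,
    real_inner_comm, real_inner_comm c x] at h1
  have h2 := hy c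
  have h3 : m / 2 * ‖y - c‖ ^ 2 ≤ 0 := by linarith
  by_contra hne
  have h4 : 0 < ‖y - c‖ := norm_pos_iff.2 (sub_ne_zero.2 hne)
  have : 0 < m / 2 * ‖y - c‖ ^ 2 := by positivity
  linarith

/-! ### Symmetric operators and the abstract contraction estimate -/

/-- A symmetric operator whose quadratic form is bounded by `σ` has norm at most `σ`. -/
theorem LinearMap.IsSymmetric.norm_apply_le_of_abs_inner_le {T : F →ₗ[ℝ] F} (hT : T.IsSymmetric)
    {σ : ℝ} (hσ : 0 ≤ σ) (h : ∀ y, |⟪T y, y⟫| ≤ σ * ‖y‖ ^ 2) (y : F) : ‖T y‖ ≤ σ * ‖y‖ := by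
  by_cases hTy : T y = 0
  · rw [hTy, norm_zero]; positivity
  have hn : 0 < ‖T y‖ := norm_pos_iff.2 hTy
  have hy : 0 < ‖y‖ := norm_pos_iff.2 fun h0 => hTy (by rw [h0, map_zero])
  -- Polarization: the form at `y + z` and `y - z` bounds `4 ⟪T y, z⟫`, and `‖z‖ = ‖y‖` lets the
  -- parallelogram law finish.
  set z := (‖y‖ / ‖T y‖) • T y with hz
  have hzn : ‖z‖ = ‖y‖ := by
    rw [hz, norm_smul, Real.norm_of_nonneg (by positivity), div_mul_cancel₀ _ hn.ne']
  have hin : ⟪T y, z⟫ = ‖y‖ * ‖T y‖ := by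
    rw [hz, inner_smul_right, real_inner_self_eq_norm_sq]
    field_simp
  have hsymm : ⟪T z, y⟫ = ⟪T y, z⟫ := by rw [hT z y, real_inner_comm]
  have h1 := (abs_le.1 (h (y + z))).2
  have h2 := (abs_le.1 (h (y - z))).1
  rw [map_add, inner_add_left, inner_add_right, inner_add_right, norm_add_sq_real, hsymm] at h1
  rw [map_sub, inner_sub_left, inner_sub_right, inner_sub_right, norm_sub_sq_real, hsymm] at h2
  rw [hzn] at h1 h2
  have h3 : ‖y‖ * ‖T y‖ ≤ ‖y‖ * (σ * ‖y‖) := by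
    rw [hin] at h1 h2
    nlinarith
  exact le_of_mul_le_mul_left h3 hy

/-- If `‖w‖ ≤ r * ‖v‖`, some symmetric operator of norm at most `r` maps `v` to `w`. -/
theorem exists_isSymmetric_apply_eq {v w : E} {r : ℝ} (hr : 0 ≤ r) (h : ‖w‖ ≤ r * ‖v‖) :
    ∃ R : E →ₗ[ℝ] E, R.IsSymmetric ∧ R v = w ∧ ∀ z, ‖R z‖ ≤ r * ‖z‖ := by
  by_cases hw : w = 0
  · refine ⟨0, fun _ _ => by simp, by simp [hw], fun z => ?_⟩
    rw [LinearMap.zero_apply, norm_zero]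
    positivity
  have hwn : 0 < ‖w‖ := norm_pos_iff.2 hw
  have hvn : 0 < ‖v‖ := by
    by_contra! h0
    have : ‖v‖ = 0 := le_antisymm h0 (norm_nonneg v)
    rw [this, mul_zero] at h
    linarith
  set w' := (‖v‖ / ‖w‖) • w with hw'
  have hn : ‖v‖ = ‖w'‖ := by
    rw [hw', norm_smul, Real.norm_of_nonneg (by positivity), div_mul_cancel₀ _ hwn.ne']
  -- Reflection in this hyperplane exchanges the equally long vectors `v` and `w'`; when they
  -- coincide it is the identity.
  let S := (Submodule.span ℝ {v - w'})ᗮ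
  have hS : S.reflection v = w' := Submodule.reflection_sub hn
  have hsymm : ∀ a b : E, ⟪S.reflection a, b⟫ = ⟪a, S.reflection b⟫ := by
    intro a b
    rw [← S.reflection.inner_map_map a (S.reflection b), Submodule.reflection_reflection]
  refine ⟨(‖w‖ / ‖v‖) • S.reflection.toLinearEquiv.toLinearMap, fun a b => ?_, ?_, fun z => ?_⟩
  · simp [real_inner_smul_left, inner_smul_right, hsymm]
  · simp only [LinearMap.smul_apply, LinearEquiv.coe_coe, LinearIsometryEquiv.coe_toLinearEquiv,
      hS, hw', smul_smul]
    rw [div_mul_div_cancel₀ hvn.ne', div_self hwn.ne', one_smul]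
  · simp only [LinearMap.smul_apply, LinearEquiv.coe_coe, LinearIsometryEquiv.coe_toLinearEquiv,
      norm_smul, LinearIsometryEquiv.norm_map]
    rw [Real.norm_of_nonneg (by positivity)]
    gcongr
    exact (div_le_iff₀ hvn).2 h

theorem inner_sub_smul_smul_sub (v u : E) (m L : ℝ) :
    ⟪v - m • u, L • u - v⟫ = (L + m) * ⟪u, v⟫ - ‖v‖ ^ 2 - m * L * ‖u‖ ^ 2 := by
  rw [inner_sub_left, inner_sub_right, inner_sub_right, inner_smul_right,
    real_inner_smul_left, inner_smul_right, real_inner_smul_left,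
    real_inner_self_eq_norm_sq, real_inner_self_eq_norm_sq, real_inner_comm]
  ring

/-- The step `v ↦ v - γ • B u` is a contraction if `u` and `Bᵀ v` satisfy the interpolation
inequality with constants `m ≤ L` and the spectrum of `B Bᵀ` lies in `[a, b]`. -/
theorem norm_sub_smul_le_of_interpolation (B : E →ₗ[ℝ] F) (Bt : F →ₗ[ℝ] E)
    (hadj : ∀ c y, ⟪B c, y⟫ = ⟪c, Bt y⟫) {a b m L : ℝ} (ha : 0 < a) (hab : a ≤ b)
    (hm : 0 < m) (hmL : m ≤ L) (hlow : ∀ y, a * ‖y‖ ^ 2 ≤ ‖Bt y‖ ^ 2)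
    (hup : ∀ y, ‖Bt y‖ ^ 2 ≤ b * ‖y‖ ^ 2) {v : F} {u : E}
    (h : 0 ≤ ⟪Bt v - m • u, L • u - Bt v⟫) :
    ‖v - (2 * L * m / (m * a + L * b)) • B u‖ ≤ (1 - 2 / (b * L / (m * a) + 1)) * ‖v‖ := by
  have hL : 0 < L := hm.trans_le hmL
  have hb : 0 < b := ha.trans_le hab
  set γ := 2 * L * m / (m * a + L * b) with hγ
  have hγ0 : 0 < γ := by positivity
  set σ := 1 - 2 / (b * L / (m * a) + 1) with hσ
  -- As `γ = 2 / (a / L + b / m)`, the extreme values of `1 - γ t` on `[a / L, b / m]` are `σ` and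
  -- `-σ`.
  have hσa : 1 - γ * (a / L) = σ := by
    rw [hγ, hσ]
    field_simp
    ring
  have hσb : 1 - γ * (b / m) = -σ := by
    rw [hγ, hσ]
    field_simp
    ring
  have hσ0 : 0 ≤ σ := by
    have h1 : a / L ≤ b / m := div_le_div₀ hb.le hab hm hmL
    have := mul_le_mul_of_nonneg_left h1 hγ0.le
    linarith
  set s := (1 / L + 1 / m) / 2 with hs
  set r := (1 / m - 1 / L) / 2 with hrdef
  have hr : 0 ≤ r := by
    have := one_div_le_one_div_of_le hm hmL
    rw [hrdef]
    linarith
  -- Completing the square in `h`, divided by `m * L`, gives this ball.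
  have hball : ‖u - s • Bt v‖ ≤ r * ‖Bt v‖ := by
    refine le_of_sq_le_sq ?_ (by positivity)
    rw [norm_sub_sq_real, inner_smul_right, norm_smul, mul_pow, mul_pow, Real.norm_eq_abs, sq_abs]
    rw [inner_sub_smul_smul_sub] at h
    have h2 : r ^ 2 * ‖Bt v‖ ^ 2 - (‖u‖ ^ 2 - 2 * (s * ⟪u, Bt v⟫) + s ^ 2 * ‖Bt v‖ ^ 2)
        = ((L + m) * ⟪u, Bt v⟫ - ‖Bt v‖ ^ 2 - m * L * ‖u‖ ^ 2) / (m * L) := by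
      rw [hs, hrdef]
      field_simp
      ring
    have h3 := div_nonneg h (mul_pos hm hL).le
    linarith
  obtain ⟨R, hRs, hRv, hRn⟩ := exists_isSymmetric_apply_eq hr hball
  have hRq : ∀ z, |⟪R z, z⟫| ≤ r * ‖z‖ ^ 2 := fun z =>
    (abs_real_inner_le_norm _ _).trans <| by
      have := mul_le_mul_of_nonneg_right (hRn z) (norm_nonneg z)
      linarith [show r * ‖z‖ * ‖z‖ = r * ‖z‖ ^ 2 by ring]
  -- Since `R` sends `Bt v` to `u - s • Bt v`, `T v` is exactly `v - γ • B u`.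
  let T : F →ₗ[ℝ] F := LinearMap.id - γ • (B ∘ₗ (s • LinearMap.id + R) ∘ₗ Bt)
  have hTapp : ∀ y, T y = y - γ • B (s • Bt y + R (Bt y)) := fun y => by simp [T]
  have hTin : ∀ y z, ⟪T y, z⟫ = ⟪y, z⟫ - γ * (s * ⟪Bt y, Bt z⟫ + ⟪R (Bt y), Bt z⟫) := by
    intro y z
    rw [hTapp, inner_sub_left, real_inner_smul_left, hadj, inner_add_left, real_inner_smul_left]
  have hTs : T.IsSymmetric := by
    intro y z
    rw [real_inner_comm (T z) y, hTin, hTin, real_inner_comm y z, real_inner_comm (Bt y) (Bt z),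
      hRs (Bt y) (Bt z), real_inner_comm (R (Bt z)) (Bt y)]
  have hTq : ∀ y, |⟪T y, y⟫| ≤ σ * ‖y‖ ^ 2 := by
    intro y
    rw [hTin, real_inner_self_eq_norm_sq, real_inner_self_eq_norm_sq]
    obtain ⟨h1, h2⟩ := abs_le.1 (hRq (Bt y))
    have h3 : a / L * ‖y‖ ^ 2 ≤ s * ‖Bt y‖ ^ 2 + ⟪R (Bt y), Bt y⟫ := by
      have h4 := mul_le_mul_of_nonneg_left (hlow y) (one_div_pos.2 hL).le
      have h5 : s * ‖Bt y‖ ^ 2 - r * ‖Bt y‖ ^ 2 = 1 / L * ‖Bt y‖ ^ 2 := by rw [hs, hrdef]; ring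
      linarith [show 1 / L * (a * ‖y‖ ^ 2) = a / L * ‖y‖ ^ 2 by ring]
    have h3' : s * ‖Bt y‖ ^ 2 + ⟪R (Bt y), Bt y⟫ ≤ b / m * ‖y‖ ^ 2 := by
      have h4 := mul_le_mul_of_nonneg_left (hup y) (one_div_pos.2 hm).le
      have h5 : s * ‖Bt y‖ ^ 2 + r * ‖Bt y‖ ^ 2 = 1 / m * ‖Bt y‖ ^ 2 := by rw [hs, hrdef]; ring
      linarith [show 1 / m * (b * ‖y‖ ^ 2) = b / m * ‖y‖ ^ 2 by ring]
    have h6 := mul_le_mul_of_nonneg_left h3 hγ0.le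
    have h7 := mul_le_mul_of_nonneg_left h3' hγ0.le
    have h8 : σ * ‖y‖ ^ 2 = ‖y‖ ^ 2 - γ * (a / L * ‖y‖ ^ 2) := by rw [← hσa]; ring
    have h9 : -(σ * ‖y‖ ^ 2) = ‖y‖ ^ 2 - γ * (b / m * ‖y‖ ^ 2) := by
      rw [← neg_mul, ← hσb]; ring
    rw [abs_le]
    constructor <;> linarith
  have hfin := hTs.norm_apply_le_of_abs_inner_le hσ0 hTq v
  rwa [hTapp, hRv, add_sub_cancel] at hfin

end Analysis

/-! ### Spectrum of the Laplacian and the reduced square root -/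

namespace DualDecomp

section Spectral

variable {N : ℕ} (G : SimpleGraph (Fin N)) [DecidableRel G.Adj] (d : ℕ)

theorem bigW_posSemidef : (bigW G d).PosSemidef :=
  (G.posSemidef_lapMatrix ℝ).kronecker Matrix.PosSemidef.one

theorem bigW_eigenvalues_nonneg (p : Fin N × Fin d) :
    0 ≤ (bigW_isHermitian G d).eigenvalues p :=
  (bigW_posSemidef G d).eigenvalues_nonneg p

theorem bigW_mulVec_apply (x : Fin N × Fin d → ℝ) (i : Fin N) (a : Fin d) :
    (bigW G d).mulVec x (i, a) = ∑ j, G.lapMatrix ℝ i j * x (j, a) := by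
  simp only [Matrix.mulVec, dotProduct, bigW, Matrix.kroneckerMap_apply, Matrix.one_apply,
    Fintype.sum_prod_type, mul_ite, mul_one, mul_zero, ite_mul, zero_mul, Finset.sum_ite_eq,
    Finset.mem_univ, if_true]

/-- Every eigenvalue of `W ⊗ I_d` is an eigenvalue of `W`. -/
theorem hasEigenvalue_lapMatrix (p : Fin N × Fin d) :
    Module.End.HasEigenvalue (Matrix.toLin' (G.lapMatrix ℝ))
      ((bigW_isHermitian G d).eigenvalues p) := by
  set hH := bigW_isHermitian G d
  set v := hH.eigenvectorBasis p with hv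
  have hne : v ≠ 0 := hH.eigenvectorBasis.orthonormal.ne_zero p
  have heq := hH.mulVec_eigenvectorBasis p
  -- `W ⊗ I_d` acts on each coordinate `a` separately, so a non-zero slice of `v` is an eigenvector
  -- of `W`.
  obtain ⟨⟨i, a⟩, hia⟩ : ∃ q, v q ≠ 0 := by
    by_contra! h
    exact hne (by ext q; simpa using h q)
  refine Module.End.hasEigenvalue_of_hasEigenvector
    (x := fun j => v (j, a)) (Module.End.hasEigenvector_iff.2
      ⟨Module.End.mem_eigenspace_iff.2 ?_, fun h => hia (congrFun h i)⟩)
  ext j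
  have := congrFun heq (j, a)
  rw [bigW_mulVec_apply] at this
  simpa [Matrix.toLin'_apply, Matrix.mulVec, dotProduct, hv] using this

theorem finite_setOf_hasEigenvalue {n : Type*} [Fintype n] [DecidableEq n] (W : Matrix n n ℝ) :
    {t : ℝ | Module.End.HasEigenvalue (Matrix.toLin' W) t}.Finite :=
  Module.End.finite_hasEigenvalue _

variable {G}

theorem le_lamMax {t : ℝ}
    (ht : Module.End.HasEigenvalue (Matrix.toLin' (G.lapMatrix ℝ)) t) :
    t ≤ lamMax (G.lapMatrix ℝ) :=
  le_csSup (finite_setOf_hasEigenvalue _).bddAbove ht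

theorem lamMinPos_le {t : ℝ}
    (ht : Module.End.HasEigenvalue (Matrix.toLin' (G.lapMatrix ℝ)) t) (ht0 : t ≠ 0) :
    lamMinPos (G.lapMatrix ℝ) ≤ t :=
  csInf_le ((finite_setOf_hasEigenvalue _).subset fun _ h => h.1).bddBelow ⟨ht, ht0⟩

theorem lapMatrix_ne_zero (hN : 2 ≤ N) (hG : G.Connected) : G.lapMatrix ℝ ≠ 0 := by
  have : Nontrivial (Fin N) := Fin.nontrivial_iff_two_le.2 hN
  let i : Fin N := ⟨0, by omega⟩
  have hdeg : 0 < G.degree i := hG.preconnected.degree_pos_of_nontrivial i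
  intro h
  have h1 := congrFun (congrFun h i) i
  simp only [SimpleGraph.lapMatrix, SimpleGraph.degMatrix, Matrix.sub_apply,
    Matrix.diagonal_apply_eq, SimpleGraph.adjMatrix_apply, SimpleGraph.irrefl, if_false,
    sub_zero, Matrix.zero_apply, Nat.cast_eq_zero] at h1
  omega

/-- A non-zero symmetric `W` has a non-zero eigenvalue, so the infimum is over a finite non-empty
set and is attained; the default `sInf ∅ = 0` is excluded. -/
theorem lamMinPos_mem (hN : 2 ≤ N) (hG : G.Connected) :
    Module.End.HasEigenvalue (Matrix.toLin' (G.lapMatrix ℝ)) (lamMinPos (G.lapMatrix ℝ)) ∧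
      lamMinPos (G.lapMatrix ℝ) ≠ 0 := by
  have hH := (G.posSemidef_lapMatrix ℝ).isHermitian
  have hne : ∃ i, hH.eigenvalues i ≠ 0 := by
    by_contra! h
    exact lapMatrix_ne_zero hN hG (hH.eigenvalues_eq_zero_iff.1 (funext h))
  obtain ⟨i, hi⟩ := hne
  refine Set.Nonempty.csInf_mem
    (s := {t : ℝ | Module.End.HasEigenvalue (Matrix.toLin' (G.lapMatrix ℝ)) t ∧ t ≠ 0})
    ⟨hH.eigenvalues i, ?_, hi⟩ ((finite_setOf_hasEigenvalue _).subset fun _ h => h.1)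
  refine Module.End.HasEigenvalue.of_mem_spectrum ?_
  rw [Matrix.spectrum_toLin']
  exact hH.eigenvalues_mem_spectrum_real i

theorem lamMinPos_pos (hN : 2 ≤ N) (hG : G.Connected) : 0 < lamMinPos (G.lapMatrix ℝ) := by
  obtain ⟨h1, h2⟩ := lamMinPos_mem hN hG
  refine lt_of_le_of_ne ?_ h2.symm
  obtain ⟨v, hv⟩ := h1.exists_hasEigenvector
  have h3 : (G.lapMatrix ℝ).mulVec v = lamMinPos (G.lapMatrix ℝ) • v := by
    simpa [Matrix.toLin'_apply] using hv.apply_eq_smul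
  have h4 := (G.posSemidef_lapMatrix ℝ).dotProduct_mulVec_nonneg v
  rw [h3, star_trivial, dotProduct_smul, smul_eq_mul] at h4
  have h5 : 0 < v ⬝ᵥ v := by
    refine lt_of_le_of_ne (Finset.sum_nonneg fun i _ => mul_self_nonneg _) fun h => hv.2 ?_
    exact dotProduct_self_eq_zero.1 h.symm
  exact nonneg_of_mul_nonneg_left h4 h5

theorem lamMinPos_le_lamMax (hN : 2 ≤ N) (hG : G.Connected) :
    lamMinPos (G.lapMatrix ℝ) ≤ lamMax (G.lapMatrix ℝ) :=
  le_lamMax (lamMinPos_mem hN hG).1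

variable (G)

theorem redSqrtW_apply (p : RowIdx G d) (q : Fin N × Fin d) :
    redSqrtW G d p q = Real.sqrt ((bigW_isHermitian G d).eigenvalues p) *
      ((bigW_isHermitian G d).eigenvectorUnitary : Matrix (Fin N × Fin d) (Fin N × Fin d) ℝ) q p := by
  simp only [redSqrtW, sqrtW, Matrix.submatrix_apply, id, Matrix.diagonal_mul,
    Matrix.transpose_apply]

/-- `Bᵀ B = W ⊗ I_d`. -/
theorem transpose_redSqrtW_mul : (redSqrtW G d).transpose * redSqrtW G d = bigW G d := by
  ext q q'
  have hs := congrFun (congrFun (bigW_isHermitian G d).spectral_theorem q) q'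
  rw [hs, Unitary.conjStarAlgAut_apply, Matrix.mul_apply, Matrix.mul_apply]
  simp only [Matrix.transpose_apply, redSqrtW_apply, Matrix.mul_diagonal, Matrix.star_apply,
    star_trivial, Function.comp_apply, RCLike.ofReal_real_eq_id, id]
  set U : Matrix (Fin N × Fin d) (Fin N × Fin d) ℝ :=
    ↑(bigW_isHermitian G d).eigenvectorUnitary
  set ev := (bigW_isHermitian G d).eigenvalues
  have h2 : ∀ p, Real.sqrt (ev p) * U q p * (Real.sqrt (ev p) * U q' p)
      = U q p * ev p * U q' p := fun p => by
    have := Real.mul_self_sqrt (bigW_eigenvalues_nonneg G d p)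
    linear_combination U q p * U q' p * this
  refine (Finset.sum_congr rfl fun (p : RowIdx G d) _ => h2 p.1).trans ?_
  rw [← Finset.sum_subtype (Finset.univ.filter fun p => ev p ≠ 0) (by simp [ev])
    fun p => U q p * ev p * U q' p]
  refine Finset.sum_filter_of_ne fun p _ hp h0 => hp ?_
  rw [h0, mul_zero, zero_mul]

/-- `B Bᵀ` is the diagonal matrix of the non-zero eigenvalues. -/
theorem redSqrtW_mul_transpose [DecidableEq (RowIdx G d)] :
    redSqrtW G d * (redSqrtW G d).transpose =
      Matrix.diagonal fun p : RowIdx G d => (bigW_isHermitian G d).eigenvalues p := by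
  ext p p'
  have hU : (star ((bigW_isHermitian G d).eigenvectorUnitary : Matrix (Fin N × Fin d) (Fin N × Fin d) ℝ)) *
      ((bigW_isHermitian G d).eigenvectorUnitary : Matrix (Fin N × Fin d) (Fin N × Fin d) ℝ) = 1 :=
    Unitary.coe_star_mul_self _
  have h1 := congrFun (congrFun hU p) p'
  rw [Matrix.mul_apply] at h1 ⊢
  simp only [Matrix.star_apply, star_trivial] at h1
  simp only [Matrix.transpose_apply, redSqrtW_apply]
  have h2 : ∀ a b x y : ℝ, a * x * (b * y) = a * b * (x * y) := fun a b x y => by ring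
  simp only [h2, ← Finset.mul_sum, h1]
  rw [Matrix.one_apply, Matrix.diagonal_apply]
  by_cases h : p = p'
  · subst h
    simp [Real.mul_self_sqrt (bigW_eigenvalues_nonneg G d _)]
  · have : (p : Fin N × Fin d) ≠ p' := fun h' => h (Subtype.ext h')
    simp [h, this]

open Classical in
/-- `M Bᵀ = I`. -/
theorem matM_mul_transpose : matM G d * (redSqrtW G d).transpose = 1 := by
  rw [matM, Matrix.mul_assoc]
  refine Matrix.nonsing_inv_mul _ ?_
  rw [redSqrtW_mul_transpose, Matrix.det_diagonal]
  exact (Finset.prod_ne_zero_iff.2 fun p _ => p.2).isUnit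

end Spectral

end DualDecomp

/-! ### The reduced variable and the weighted norm -/

namespace DualDecomp

open scoped RealInnerProductSpace

section Reduced

variable {N : ℕ} (G : SimpleGraph (Fin N)) [DecidableRel G.Adj] (d : ℕ)

/-- The space of the reduced dual variable `y`, for which `x = Bᵀ y`. -/
abbrev Reduced : Type := EuclideanSpace ℝ (RowIdx G d)

/-- The linear map given by `B`. -/
noncomputable def linB : Stacked N d →ₗ[ℝ] Reduced G d :=
  Matrix.toEuclideanLin (redSqrtW G d)

/-- The linear map given by `Bᵀ`. -/
noncomputable def linBt : Reduced G d →ₗ[ℝ] Stacked N d :=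
  Matrix.toEuclideanLin (redSqrtW G d).transpose

/-- The linear map given by `M`. -/
noncomputable def linM : Stacked N d →ₗ[ℝ] Reduced G d :=
  Matrix.toEuclideanLin (matM G d)

theorem inner_linB (c : Stacked N d) (y : Reduced G d) :
    ⟪linB G d c, y⟫ = ⟪c, linBt G d y⟫ := by
  rw [linB, linBt, ← Matrix.conjTranspose_eq_transpose_of_trivial,
    Matrix.toEuclideanLin_conjTranspose_eq_adjoint, LinearMap.adjoint_inner_right]

theorem linBt_linB (c : Stacked N d) :
    linBt G d (linB G d c) = Matrix.toEuclideanLin (bigW G d) c := by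
  rw [← transpose_redSqrtW_mul]
  simp [linB, linBt, Matrix.toLpLin_apply, Matrix.mulVec_mulVec]

theorem linB_linBt_apply (y : Reduced G d) (p : RowIdx G d) :
    linB G d (linBt G d y) p = (bigW_isHermitian G d).eigenvalues p * y p := by
  simp only [linB, linBt, Matrix.toLpLin_apply, Matrix.mulVec_mulVec, redSqrtW_mul_transpose,
    Matrix.mulVec_diagonal]

theorem linM_linBt (y : Reduced G d) : linM G d (linBt G d y) = y := by
  have h := matM_mul_transpose G d
  simp only [linM, linBt, Matrix.toLpLin_apply, Matrix.mulVec_mulVec, h, Matrix.one_mulVec]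

theorem normM_eq (x : Stacked N d) : normM G x = ‖linM G d x‖ := rfl

/-- The isometry that moves every estimate in `‖·‖_M` to the Euclidean reduced space. -/
theorem normM_linBt (y : Reduced G d) : normM G (linBt G d y) = ‖y‖ := by
  rw [normM_eq, linM_linBt]

/-- `X` is the range of `Bᵀ`. -/
theorem mem_imW_iff {x : Stacked N d} : x ∈ imW G d ↔ ∃ y, linBt G d y = x := by
  constructor
  · rintro ⟨c, rfl⟩
    exact ⟨linB G d c, linBt_linB G d c⟩
  · rintro ⟨y, rfl⟩
    -- `B Bᵀ` is diagonal with non-zero entries, so dividing by the eigenvalues inverts it.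
    refine ⟨linBt G d (WithLp.toLp 2 fun p => y p / (bigW_isHermitian G d).eigenvalues p), ?_⟩
    rw [← linBt_linB]
    congr 1
    ext p
    rw [linB_linBt_apply]
    exact mul_div_cancel₀ _ p.2

theorem norm_sq_linBt (y : Reduced G d) :
    ‖linBt G d y‖ ^ 2 = ∑ p : RowIdx G d, (bigW_isHermitian G d).eigenvalues p * y p ^ 2 := by
  rw [← real_inner_self_eq_norm_sq, ← inner_linB, PiLp.inner_apply]
  refine Finset.sum_congr rfl fun p _ => ?_
  rw [linB_linBt_apply]
  simp
  ring

/-- `RowIdx` omits the kernel of `W ⊗ I_d`, so only non-zero eigenvalues enter the sum. -/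
theorem lamMinPos_mul_le_norm_sq_linBt (y : Reduced G d) :
    lamMinPos (G.lapMatrix ℝ) * ‖y‖ ^ 2 ≤ ‖linBt G d y‖ ^ 2 := by
  rw [norm_sq_linBt, EuclideanSpace.real_norm_sq_eq, Finset.mul_sum]
  gcongr with p
  exact lamMinPos_le (hasEigenvalue_lapMatrix G d p) p.2

theorem norm_sq_linBt_le_lamMax_mul (y : Reduced G d) :
    ‖linBt G d y‖ ^ 2 ≤ lamMax (G.lapMatrix ℝ) * ‖y‖ ^ 2 := by
  rw [norm_sq_linBt, EuclideanSpace.real_norm_sq_eq, Finset.mul_sum]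
  gcongr with p
  exact le_lamMax (hasEigenvalue_lapMatrix G d p)

theorem isNormOn_normM : IsNormOn (imW G d) (normM G) := by
  refine ⟨fun x _ => norm_nonneg _, fun x hx => ?_, fun a x _ => ?_, fun x _ y _ => ?_⟩
  · obtain ⟨y, rfl⟩ := (mem_imW_iff G d).1 hx
    rw [normM_linBt, norm_eq_zero]
    refine ⟨fun h => by rw [h, map_zero], fun h => ?_⟩
    rw [← linM_linBt G d y, h, map_zero]
  · rw [normM_eq, map_smul, norm_smul, Real.norm_eq_abs, normM_eq]
  · simp only [normM_eq, map_add]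
    exact norm_add_le _ _

variable {d}

theorem algMap_eq (γ : ℝ) (c x : Stacked N d) :
    algMap G γ c x = x + γ • Matrix.toEuclideanLin (bigW G d) c := by
  ext ⟨i, a⟩
  simp [algMap, stack, block, Matrix.toLpLin_apply, bigW_mulVec_apply]

theorem algMap_linBt (γ : ℝ) (c : Stacked N d) (y : Reduced G d) :
    algMap G γ c (linBt G d y) = linBt G d (y + γ • linB G d c) := by
  rw [algMap_eq, map_add, map_smul, linBt_linB]

theorem algMap_mem_imW (γ : ℝ) (c : Stacked N d) {x : Stacked N d} (hx : x ∈ imW G d) :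
    algMap G γ c x ∈ imW G d := by
  rw [algMap_eq]
  exact add_mem hx (Submodule.smul_mem _ _ ⟨c, rfl⟩)

theorem iterates_mem_imW (f : Fin N → Loc d → ℝ) (γ : ℝ) (k : ℕ) :
    (iterates G f γ k).1 ∈ imW G d := by
  induction k with
  | zero => exact zero_mem _
  | succ k ih => exact algMap_mem_imW G γ _ ih

theorem exists_normM_algMap_sub_le (γ : ℝ) : ∃ LA : ℝ, 0 ≤ LA ∧
    ∀ c₁ c₂ : Stacked N d, ∀ x ∈ imW G d,
      normM G (algMap G γ c₁ x - algMap G γ c₂ x) ≤ LA * linfNorm (c₁ - c₂) := by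
  -- The difference `γ (W ⊗ I_d) (c₁ - c₂)` does not involve `x`; a linear map from a
  -- finite-dimensional sup-norm space is bounded.
  let T : (Fin N × Fin d → ℝ) →ₗ[ℝ] Reduced G d :=
    γ • (linM G d ∘ₗ Matrix.toEuclideanLin (bigW G d) ∘ₗ
      (WithLp.linearEquiv 2 ℝ (Fin N × Fin d → ℝ)).symm.toLinearMap)
  refine ⟨‖T.toContinuousLinearMap‖, norm_nonneg _, fun c₁ c₂ x _ => ?_⟩
  have h := T.toContinuousLinearMap.le_opNorm (WithLp.ofLp (c₁ - c₂))
  have h2 : linM G d (algMap G γ c₁ x - algMap G γ c₂ x) = T (WithLp.ofLp (c₁ - c₂)) := by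
    rw [algMap_eq, algMap_eq, add_sub_add_left_eq_sub, ← smul_sub, ← map_sub, map_smul]
    rfl
  rw [normM_eq, h2]
  exact h

end Reduced

/-! ### Regularity of the communication map -/

section Primal

variable {N d : ℕ} {f : Fin N → Loc d → ℝ} {μ : ℝ} {L : ℝ≥0}

theorem inner_eq_sum_block (x y : Stacked N d) : ⟪x, y⟫ = ∑ i, ⟪block x i, block y i⟫ := by
  simp [PiLp.inner_apply, Fintype.sum_prod_type, block]

/-- The communication map attains the local minima. -/
theorem localObj_block_commMap_le (hμ : 0 < μ) (hconv : ∀ i, StrongConvexOn Set.univ μ (f i))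
    (hdiff : ∀ i, Differentiable ℝ (f i)) (x : Stacked N d) (i : Fin N) (c : Loc d) :
    localObj (f i) (block x i) (block (commMap f x) i) ≤ localObj (f i) (block x i) c :=
  Classical.epsilon_spec ((hconv i).exists_forall_add_inner_le hμ (hdiff i) (block x i)) c

/-- The gradient of `f_i` at `C_i(x_i)` is `-x_i`. -/
theorem gradient_block_commMap (hμ : 0 < μ) (hconv : ∀ i, StrongConvexOn Set.univ μ (f i))
    (hdiff : ∀ i, Differentiable ℝ (f i)) (x : Stacked N d) (i : Fin N) :
    gradient (f i) (block (commMap f x) i) = -block x i :=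
  gradient_eq_neg_of_forall_add_inner_le (hdiff i)
    (localObj_block_commMap_le hμ hconv hdiff x i)

/-- The interpolation inequality for the communication map. -/
theorem interpolation_commMap (hμ : 0 < μ) (hμL : μ ≤ L)
    (hconv : ∀ i, StrongConvexOn Set.univ μ (f i)) (hdiff : ∀ i, Differentiable ℝ (f i))
    (hsmooth : ∀ i, LipschitzWith L (gradient (f i))) (x₁ x₂ : Stacked N d) :
    0 ≤ ⟪(x₁ - x₂) - μ • (commMap f x₂ - commMap f x₁),
      (L : ℝ) • (commMap f x₂ - commMap f x₁) - (x₁ - x₂)⟫ := by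
  rw [inner_eq_sum_block]
  refine Finset.sum_nonneg fun i _ => ?_
  have h := (hconv i).inner_gradient_sub_nonneg (hdiff i) (hsmooth i) hμL
    (block (commMap f x₂) i) (block (commMap f x₁) i)
  rw [gradient_block_commMap hμ hconv hdiff, gradient_block_commMap hμ hconv hdiff,
    neg_sub_neg] at h
  exact h

/-- The communication map is Lipschitz with constant `1 / μ` for the Euclidean norm. -/
theorem norm_commMap_sub_le (hμ : 0 < μ) (hμL : μ ≤ L)
    (hconv : ∀ i, StrongConvexOn Set.univ μ (f i)) (hdiff : ∀ i, Differentiable ℝ (f i))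
    (hsmooth : ∀ i, LipschitzWith L (gradient (f i))) (x₁ x₂ : Stacked N d) :
    ‖commMap f x₁ - commMap f x₂‖ ≤ 1 / μ * ‖x₁ - x₂‖ := by
  have h := interpolation_commMap hμ hμL hconv hdiff hsmooth x₁ x₂
  rw [norm_sub_rev]
  set u := commMap f x₂ - commMap f x₁
  set v := x₁ - x₂
  rw [inner_sub_smul_smul_sub] at h
  have h2 := mul_le_mul_of_nonneg_left (real_inner_le_norm u v)
    (add_nonneg L.coe_nonneg hμ.le)
  -- By Cauchy–Schwarz the interpolation inequality passes to norms. If `‖v‖ < μ ‖u‖`, then the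
  -- second factor gives `L ‖u‖ ≤ ‖v‖ < μ ‖u‖`, against `μ ≤ L`.
  have h3 : 0 ≤ (‖v‖ - μ * ‖u‖) * (L * ‖u‖ - ‖v‖) := by nlinarith
  rw [one_div, ← div_eq_inv_mul, le_div_iff₀ hμ]
  by_contra! hlt
  have h4 : L * ‖u‖ - ‖v‖ ≤ 0 := by
    by_contra! h5
    nlinarith
  have h5 : μ * ‖u‖ ≤ L * ‖u‖ := mul_le_mul_of_nonneg_right hμL (norm_nonneg u)
  linarith

end Primal

/-! ### Contraction and the fixed point -/

section Contraction

variable {N d : ℕ} (G : SimpleGraph (Fin N)) [DecidableRel G.Adj] {f : Fin N → Loc d → ℝ}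
  {μ : ℝ} {L : ℝ≥0}

/-- The iteration `x ↦ A(C(x), x)` in the reduced variable. -/
noncomputable def redStep (f : Fin N → Loc d → ℝ) (γ : ℝ) (y : Reduced G d) : Reduced G d :=
  y + γ • linB G d (commMap f (linBt G d y))

theorem algMap_commMap_linBt (γ : ℝ) (y : Reduced G d) :
    algMap G γ (commMap f (linBt G d y)) (linBt G d y) = linBt G d (redStep G f γ y) :=
  algMap_linBt G γ _ y

variable {G}

theorem norm_redStep_sub_le (hN : 2 ≤ N) (hG : G.Connected) (hμ : 0 < μ) (hμL : μ ≤ L)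
    (hconv : ∀ i, StrongConvexOn Set.univ μ (f i)) (hdiff : ∀ i, Differentiable ℝ (f i))
    (hsmooth : ∀ i, LipschitzWith L (gradient (f i))) (y₁ y₂ : Reduced G d) :
    ‖redStep G f (stepSize G μ L) y₁ - redStep G f (stepSize G μ L) y₂‖
      ≤ rate G μ L * ‖y₁ - y₂‖ := by
  have h := interpolation_commMap hμ hμL hconv hdiff hsmooth (linBt G d y₁) (linBt G d y₂)
  rw [← map_sub] at h
  have h1 := norm_sub_smul_le_of_interpolation (linB G d) (linBt G d) (inner_linB G d)
    (lamMinPos_pos hN hG) (lamMinPos_le_lamMax hN hG) hμ hμL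
    (lamMinPos_mul_le_norm_sq_linBt G d) (norm_sq_linBt_le_lamMax_mul G d) h
  -- Exchanging the arguments of `C` absorbs the sign in `∇f_i(C_i(x_i)) = -x_i` and gives the form
  -- `v - γ • B u`.
  have h2 : redStep G f (stepSize G μ L) y₁ - redStep G f (stepSize G μ L) y₂
      = (y₁ - y₂) - stepSize G μ L •
        linB G d (commMap f (linBt G d y₂) - commMap f (linBt G d y₁)) := by
    rw [redStep, redStep, map_sub, smul_sub]
    abel
  rw [h2]
  exact h1

theorem rate_nonneg (hN : 2 ≤ N) (hG : G.Connected) (hμ : 0 < μ) (hμL : μ ≤ L) :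
    0 ≤ rate G μ L := by
  have ha := lamMinPos_pos hN hG
  have hab := lamMinPos_le_lamMax hN hG
  have h1 : 1 ≤ kappa G μ L := by
    rw [kappa, one_le_div (mul_pos hμ ha), mul_comm μ]
    exact mul_le_mul hab hμL hμ.le (ha.trans_le hab).le
  rw [rate, sub_nonneg, div_le_one (by linarith)]
  linarith

theorem rate_lt_one (hN : 2 ≤ N) (hG : G.Connected) (hμ : 0 < μ) (hμL : μ ≤ L) :
    rate G μ L < 1 := by
  have ha := lamMinPos_pos hN hG
  have hb := ha.trans_le (lamMinPos_le_lamMax hN hG)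
  have hL : (0 : ℝ) < L := hμ.trans_le hμL
  have h1 : 0 < kappa G μ L := div_pos (mul_pos hb hL) (mul_pos hμ ha)
  exact sub_lt_self 1 (by positivity)

theorem exists_fixedPoint_redStep (hN : 2 ≤ N) (hG : G.Connected) (hμ : 0 < μ) (hμL : μ ≤ L)
    (hconv : ∀ i, StrongConvexOn Set.univ μ (f i)) (hdiff : ∀ i, Differentiable ℝ (f i))
    (hsmooth : ∀ i, LipschitzWith L (gradient (f i))) :
    ∃ y : Reduced G d, redStep G f (stepSize G μ L) y = y := by
  have hc : ContractingWith ⟨rate G μ L, rate_nonneg hN hG hμ hμL⟩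
      (redStep G f (stepSize G μ L)) := by
    refine ⟨NNReal.coe_lt_coe.1 (rate_lt_one hN hG hμ hμL), LipschitzWith.of_dist_le_mul ?_⟩
    intro y₁ y₂
    rw [dist_eq_norm, dist_eq_norm]
    exact norm_redStep_sub_le hN hG hμ hμL hconv hdiff hsmooth y₁ y₂
  exact ⟨hc.fixedPoint, hc.fixedPoint_isFixedPt⟩

theorem exists_linfNorm_commMap_sub_le (hμ : 0 < μ) (hμL : μ ≤ L)
    (hconv : ∀ i, StrongConvexOn Set.univ μ (f i)) (hdiff : ∀ i, Differentiable ℝ (f i))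
    (hsmooth : ∀ i, LipschitzWith L (gradient (f i))) : ∃ LC : ℝ, 0 ≤ LC ∧
      ∀ x₁ ∈ imW G d, ∀ x₂ ∈ imW G d,
        linfNorm (commMap f x₁ - commMap f x₂) ≤ LC * normM G (x₁ - x₂) := by
  refine ⟨1 / μ * ‖(linBt G d).toContinuousLinearMap‖, by positivity, fun x₁ h₁ x₂ h₂ => ?_⟩
  -- With `x₁ - x₂ = Bᵀ y`, the operator norm of `Bᵀ` bounds the Euclidean norm by `‖y‖ = ‖x₁ -
  -- x₂‖_M`.
  obtain ⟨y, hy⟩ := (mem_imW_iff G d).1 (sub_mem h₁ h₂)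
  have h1 : linfNorm (commMap f x₁ - commMap f x₂) ≤ ‖commMap f x₁ - commMap f x₂‖ :=
    (pi_norm_le_iff_of_nonneg (norm_nonneg _)).2 fun p => PiLp.norm_apply_le _ p
  have h2 := norm_commMap_sub_le hμ hμL hconv hdiff hsmooth x₁ x₂
  have h3 := (linBt G d).toContinuousLinearMap.le_opNorm y
  rw [LinearMap.coe_toContinuousLinearMap', hy] at h3
  rw [← hy, normM_linBt, mul_assoc]
  rw [← hy] at h2 h3
  exact (h1.trans h2).trans (mul_le_mul_of_nonneg_left h3 (by positivity))

end Contraction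

end DualDecomp

theorem mainTheorem2 {N d : ℕ} (hN : 2 ≤ N) (hd : 0 < d)
    (G : SimpleGraph (Fin N)) [DecidableRel G.Adj] (hG : G.Connected)
    (f : Fin N → DualDecomp.Loc d → ℝ) (μ : ℝ) (L : ℝ≥0) (hμ : 0 < μ)
    (hconv : ∀ i, StrongConvexOn Set.univ μ (f i))
    (hdiff : ∀ i, Differentiable ℝ (f i))
    (hsmooth : ∀ i, LipschitzWith L (gradient (f i))) :
    -- the local minimization problems that define `C` have exactly one solution
    (∀ (i : Fin N) (xi : DualDecomp.Loc d),
      ∃! c, ∀ c', DualDecomp.localObj (f i) xi c ≤ DualDecomp.localObj (f i) xi c') ∧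
    -- invariance of `X`, for every step size
    (∀ (γ : ℝ) (c : DualDecomp.Stacked N d), ∀ x ∈ DualDecomp.imW G d,
      DualDecomp.algMap G γ c x ∈ DualDecomp.imW G d) ∧
    (∀ (γ : ℝ) (k : ℕ), (DualDecomp.iterates G f γ k).1 ∈ DualDecomp.imW G d) ∧
    -- the weighted norm is a norm on `X`, and the rate is a contraction factor
    DualDecomp.IsNormOn (DualDecomp.imW G d) (DualDecomp.normM G) ∧
    0 ≤ DualDecomp.rate G μ L ∧ DualDecomp.rate G μ L < 1 ∧
    -- contraction towards the unique fixed point in `X`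
    (∃ xs ∈ DualDecomp.imW G d,
      DualDecomp.algMap G (DualDecomp.stepSize G μ L) (DualDecomp.commMap f xs) xs = xs ∧
      (∀ y ∈ DualDecomp.imW G d,
        DualDecomp.algMap G (DualDecomp.stepSize G μ L) (DualDecomp.commMap f y) y = y →
          y = xs) ∧
      ∀ x ∈ DualDecomp.imW G d,
        DualDecomp.normM G
            (DualDecomp.algMap G (DualDecomp.stepSize G μ L) (DualDecomp.commMap f x) x - xs) ≤
          DualDecomp.rate G μ L * DualDecomp.normM G (x - xs)) ∧
    -- Lipschitz constants, for every step size
    (∀ γ : ℝ, ∃ LA : ℝ, 0 ≤ LA ∧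
      ∀ c₁ c₂ : DualDecomp.Stacked N d, ∀ x ∈ DualDecomp.imW G d,
        DualDecomp.normM G (DualDecomp.algMap G γ c₁ x - DualDecomp.algMap G γ c₂ x) ≤
          LA * DualDecomp.linfNorm (c₁ - c₂)) ∧
    (∃ LC : ℝ, 0 ≤ LC ∧
      ∀ x₁ ∈ DualDecomp.imW G d, ∀ x₂ ∈ DualDecomp.imW G d,
        DualDecomp.linfNorm (DualDecomp.commMap f x₁ - DualDecomp.commMap f x₂) ≤
          LC * DualDecomp.normM G (x₁ - x₂)) := by
  -- On the zero space `μ ≤ L` could fail; this is where `0 < d` enters.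
  have : Nontrivial (DualDecomp.Loc d) := by
    have : Nonempty (Fin d) := ⟨⟨0, hd⟩⟩
    infer_instance
  have hμL : μ ≤ L :=
    (hconv ⟨0, by omega⟩).le_of_lipschitzWith_gradient (hdiff _) (hsmooth _)
  refine ⟨fun i xi => (hconv i).existsUnique_forall_add_inner_le hμ (hdiff i) xi,
    fun γ c x hx => DualDecomp.algMap_mem_imW G γ c hx,
    fun γ k => DualDecomp.iterates_mem_imW G f γ k, DualDecomp.isNormOn_normM G d,
    DualDecomp.rate_nonneg hN hG hμ hμL, DualDecomp.rate_lt_one hN hG hμ hμL, ?_,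
    fun γ => DualDecomp.exists_normM_algMap_sub_le G γ,
    DualDecomp.exists_linfNorm_commMap_sub_le hμ hμL hconv hdiff hsmooth⟩
  obtain ⟨ys, hys⟩ :=
    DualDecomp.exists_fixedPoint_redStep hN hG hμ hμL hconv hdiff hsmooth
  have hcontr : ∀ x ∈ DualDecomp.imW G d,
      DualDecomp.normM G
          (DualDecomp.algMap G (DualDecomp.stepSize G μ L) (DualDecomp.commMap f x) x -
            DualDecomp.linBt G d ys) ≤
        DualDecomp.rate G μ L * DualDecomp.normM G (x - DualDecomp.linBt G d ys) := by
    intro x hx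
    obtain ⟨y, rfl⟩ := (DualDecomp.mem_imW_iff G d).1 hx
    have h := DualDecomp.norm_redStep_sub_le hN hG hμ hμL hconv hdiff hsmooth y ys
    rw [hys] at h
    rwa [DualDecomp.algMap_commMap_linBt, ← map_sub, ← map_sub, DualDecomp.normM_linBt,
      DualDecomp.normM_linBt]
  have hmem : DualDecomp.linBt G d ys ∈ DualDecomp.imW G d :=
    (DualDecomp.mem_imW_iff G d).2 ⟨ys, rfl⟩
  refine ⟨DualDecomp.linBt G d ys, hmem, ?_, fun y hy hfix => ?_, hcontr⟩
  · rw [DualDecomp.algMap_commMap_linBt, hys]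
  · have h := hcontr y hy
    rw [hfix] at h
    have h1 := DualDecomp.rate_lt_one hN hG hμ hμL
    have hsub := sub_mem hy hmem
    have h2 := (DualDecomp.isNormOn_normM G d).1 _ hsub
    -- A second fixed point has distance to the first at most `σ < 1` times itself.
    have h3 : DualDecomp.normM G (y - DualDecomp.linBt G d ys) = 0 := by nlinarith
    exact sub_eq_zero.1 (((DualDecomp.isNormOn_normM G d).2.1 _ hsub).1 h3)
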